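/- A binary $[n,k]$ code is a $k$-dimensional subspace $C$ of $\mathbb{F}_2^n$. Its minimum weight is the smallest number of nonzero coordinates of a nonzero vector of $C$, and its dual is $C^\perp=\{x\in\mathbb{F}_2^n : \sum_{i=1}^n x_iy_i=0 \text{ for all } y\in C\}$. The code $C$ is linear complementary dual (LCD) if $C\cap C^\perp=\{0\}$. Let $d_2(n,k)$ denote the largest minimum weight among all binary LCD $[n,k]$ codes. Theorem. Let $n\ge 5$ be an integer. If $n\equiv 1,9,13,15,17,21,23,24,25,27,28,29,30 \pmod{31}$, then $$d_2(n,5)=\left\lfloor \frac{16n}{31}\right\rfloor-1.$$ If $n\equiv 0,6 \pmod{31}$, then $$d_2(n,5)=\left\lfloor \frac{16n}{31}\right\rfloor-2.$$ -/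

import Mathlib

/-- The (Euclidean) dual code `C^⊥ = {x | ⟨x, y⟩ = 0 for all y ∈ C}` of a linear code `C`
of length `n` over `F`, where `⟨x, y⟩ = ∑ i, x i * y i`. -/
def dualCode {F : Type*} [Field F] {n : ℕ} (C : Submodule F (Fin n → F)) :
    Submodule F (Fin n → F) where
  carrier := {x | ∀ y ∈ C, ∑ i, x i * y i = 0}
  zero_mem' := by
    intro y _
    simp
  add_mem' := by
    intro a b ha hb y hy
    simp only [Pi.add_apply, add_mul, Finset.sum_add_distrib]
    rw [ha y hy, hb y hy, add_zero]
  smul_mem' := by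
    intro c a ha y hy
    simp only [Pi.smul_apply, smul_eq_mul, mul_assoc, ← Finset.mul_sum]
    rw [ha y hy, mul_zero]

/-- A linear code is linear complementary dual (LCD) if `C ∩ C^⊥ = {0}`. -/
def IsLCD {F : Type*} [Field F] {n : ℕ} (C : Submodule F (Fin n → F)) : Prop :=
  C ⊓ dualCode C = ⊥

/-- The minimum weight of a code: the smallest Hamming weight of a nonzero codeword. -/
noncomputable def minWeight {F : Type*} [Field F] [DecidableEq F] {n : ℕ}
    (C : Submodule F (Fin n → F)) : ℕ :=
  sInf {w | ∃ x ∈ C, x ≠ 0 ∧ hammingNorm x = w}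

/-- The minimum weights of all LCD `[n, k]` codes over `F`. -/
def lcdMinWeights (F : Type*) [Field F] [DecidableEq F] (n k : ℕ) : Set ℕ :=
  {d | ∃ C : Submodule F (Fin n → F), Module.finrank F C = k ∧ IsLCD C ∧ minWeight C = d}

/-- `d_q(n, k)`, for `F` the field with `q` elements: the largest minimum weight among all
LCD `[n, k]` codes over `F`. -/
noncomputable def largestLCDMinWeight (F : Type*) [Field F] [DecidableEq F] (n k : ℕ) : ℕ :=
  sSup (lcdMinWeights F n k)

theorem minWeight_le_length {F : Type*} [Field F] [DecidableEq F] {n : ℕ}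
    (C : Submodule F (Fin n → F)) : minWeight C ≤ n := by
  unfold minWeight
  rcases Set.eq_empty_or_nonempty {w | ∃ x ∈ C, x ≠ 0 ∧ hammingNorm x = w} with h | ⟨w, hw⟩
  · rw [h]
    simp
  · refine (Nat.sInf_le hw).trans ?_
    obtain ⟨x, _, _, rfl⟩ := hw
    simpa using hammingNorm_le_card_fintype (x := x)

/-- The supremum defining `d_q(n, k)` is attained as soon as an LCD `[n, k]` code exists. -/
theorem isGreatest_largestLCDMinWeight {F : Type*} [Field F] [DecidableEq F] {n k : ℕ}
    (h : (lcdMinWeights F n k).Nonempty) :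
    IsGreatest (lcdMinWeights F n k) (largestLCDMinWeight F n k) := by
  have hb : BddAbove (lcdMinWeights F n k) := by
    refine ⟨n, ?_⟩
    rintro d ⟨C, _, _, rfl⟩
    exact minWeight_le_length C
  exact ⟨Nat.sSup_mem h hb, fun d hd => le_csSup hb hd⟩

/-!
Let `G` encode a binary LCD code of dimension 5, of length `n` and with minimum weight at least `d`.
Nondegeneracy of the Gram form turns `∑ u, i ^ wt (G u)` into a quadratic Gauss sum of squared
modulus 32. As `32 = 4² + 4²` is the only way to write 32 as a sum of two squares, odd weights
occur, and the numbers of codewords of weight 0 and 2 modulo 4 are 10 and 6 in some order.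

Consider half the excess of each nonzero weight over `d`, rounded down, as a multiset of messages.
Fourier inversion shows that the complement of every hyperplane contains a multiple of four of its
elements, and that it has at most nine elements if `31 d + 35 > 16 n`. Modulo 4, the second moment
of such a multiset then contradicts the number of even-weight messages of odd multiplicity, which
the weight distribution prescribes. Hence `31 d + 35 ≤ 16 n`.

Conversely, the simplex code is self-orthogonal, so appending it to an LCD code leaves the Gram
matrix unchanged while it adds 31 to the length and 16 to the weights of all nonzero codewords.
One explicit code for each residue class of lengths modulo 31 therefore suffices.
-/

open Finset Module

section SignCharacter

/-- The character `a ↦ (-1) ^ a` of `ZMod 2` with values in a commutative ring `R`. -/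
def signChar (R : Type*) [CommRing R] : AddChar (ZMod 2) R :=
  AddChar.zmodChar 2 neg_one_sq

theorem signChar_natCast (R : Type*) [CommRing R] (n : ℕ) :
    signChar R (n : ZMod 2) = (-1) ^ n :=
  AddChar.zmodChar_apply' neg_one_sq n

theorem signChar_eq_ite (R : Type*) [CommRing R] (a : ZMod 2) :
    signChar R a = if a = 0 then 1 else -1 := by
  obtain rfl | rfl : a = 0 ∨ a = 1 := by revert a; decide
  · simp
  · simpa using signChar_natCast R 1

variable {ι : Type*} [Fintype ι]

theorem two_mul_sum_filter_ne_zero (f : ι → ℤ) (a : ι → ZMod 2) :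
    2 * ∑ i with a i ≠ 0, f i = ∑ i, f i - ∑ i, f i * signChar ℤ (a i) := by
  rw [sum_filter, mul_sum, ← sum_sub_distrib]
  refine sum_congr rfl fun i _ => ?_
  rw [signChar_eq_ite]
  split_ifs <;> grind

theorem two_mul_hammingNorm (x : ι → ZMod 2) :
    2 * (hammingNorm x : ℤ) = Fintype.card ι - ∑ i, signChar ℤ (x i) := by
  simpa [hammingNorm] using two_mul_sum_filter_ne_zero 1 x

theorem sum_eq_hammingNorm (x : ι → ZMod 2) : ∑ i, x i = (hammingNorm x : ZMod 2) := by
  have eq_ite : ∀ a : ZMod 2, a = if a ≠ 0 then 1 else 0 := by decide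
  rw [sum_congr rfl fun i _ => eq_ite (x i), sum_boole, hammingNorm]

theorem dotProduct_eq_card (x y : ι → ZMod 2) :
    x ⬝ᵥ y = (#{i | x i ≠ 0 ∧ y i ≠ 0} : ZMod 2) := by
  have mul_eq_ite : ∀ a b : ZMod 2, a * b = if a ≠ 0 ∧ b ≠ 0 then 1 else 0 := by decide
  rw [dotProduct, sum_congr rfl fun i _ => mul_eq_ite (x i) (y i), sum_boole]

theorem hammingNorm_add_add_two_mul_card (x y : ι → ZMod 2) :
    hammingNorm (x + y) + 2 * #{i | x i ≠ 0 ∧ y i ≠ 0} = hammingNorm x + hammingNorm y := by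
  have pointwise : ∀ a b : ZMod 2, ((if a + b ≠ 0 then 1 else 0) +
      2 * if a ≠ 0 ∧ b ≠ 0 then 1 else 0 : ℕ) =
      (if a ≠ 0 then 1 else 0) + if b ≠ 0 then 1 else 0 := by decide
  simp only [hammingNorm, card_filter, mul_sum, ← sum_add_distrib]
  exact sum_congr rfl fun i _ => pointwise (x i) (y i)

theorem dotProduct_eq_zero_of_four_dvd {x y : ι → ZMod 2} (hx : 4 ∣ hammingNorm x)
    (hy : 4 ∣ hammingNorm y) (hxy : 4 ∣ hammingNorm (x + y)) : x ⬝ᵥ y = 0 := by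
  rw [dotProduct_eq_card, ZMod.natCast_eq_zero_iff]
  have := hammingNorm_add_add_two_mul_card x y
  omega

end SignCharacter

section BinarySpace

variable {V : Type*} [AddCommGroup V] [Module (ZMod 2) V] [Fintype V]

open Classical in
theorem sum_signChar_apply (φ : Dual (ZMod 2) V) :
    ∑ u, signChar ℤ (φ u) = if φ = 0 then (Fintype.card V : ℤ) else 0 := by
  have trivial_iff : (signChar ℤ).compAddMonoidHom φ.toAddMonoidHom = 0 ↔ φ = 0 := by
    simp [DFunLike.ext_iff, signChar_eq_ite]
  simpa [trivial_iff] using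
    ((signChar ℤ).compAddMonoidHom φ.toAddMonoidHom).sum_eq_ite

variable [Fintype (Dual (ZMod 2) V)]

theorem card_dual_zmod_two : Fintype.card (Dual (ZMod 2) V) = Fintype.card V := by
  rw [card_eq_pow_finrank (K := ZMod 2), card_eq_pow_finrank (K := ZMod 2) (V := V),
    Subspace.dual_finrank_eq]

open Classical in
theorem sum_dual_signChar_apply (v : V) :
    ∑ φ : Dual (ZMod 2) V, signChar ℤ (φ v) = if v = 0 then (Fintype.card V : ℤ) else 0 := by
  have eval_eq_zero_iff : Dual.eval (ZMod 2) V v = 0 ↔ v = 0 := by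
    simp [LinearMap.ext_iff, forall_dual_apply_eq_zero_iff]
  simpa [card_dual_zmod_two, eval_eq_zero_iff] using sum_signChar_apply (Dual.eval (ZMod 2) V v)

theorem sum_dual_sum_mul_signChar (f : V → ℤ) :
    ∑ φ : Dual (ZMod 2) V, ∑ u, f u * signChar ℤ (φ u) = Fintype.card V * f 0 := by
  classical
  rw [sum_comm]
  simp [← mul_sum, sum_dual_signChar_apply, mul_comm]

theorem sum_dual_sq_sum_mul_signChar (f : V → ℤ) :
    ∑ φ : Dual (ZMod 2) V, (∑ u, f u * signChar ℤ (φ u)) ^ 2 =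
      Fintype.card V * ∑ u, f u ^ 2 := by
  classical
  have expand (φ : Dual (ZMod 2) V) : (∑ u, f u * signChar ℤ (φ u)) ^ 2 =
      ∑ u, ∑ v, f u * f v * signChar ℤ (φ (u - v)) := by
    rw [sq, sum_mul_sum]
    refine sum_congr rfl fun u _ => sum_congr rfl fun v _ => ?_
    rw [ZModModule.sub_eq_add u v, map_add, AddChar.map_add_eq_mul]
    ring
  calc ∑ φ : Dual (ZMod 2) V, (∑ u, f u * signChar ℤ (φ u)) ^ 2
    _ = ∑ u, ∑ v, f u * f v * ∑ φ : Dual (ZMod 2) V, signChar ℤ (φ (u - v)) := by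
      simp only [expand, mul_sum]
      rw [sum_comm]
      exact sum_congr rfl fun u _ => sum_comm
    _ = Fintype.card V * ∑ u, f u ^ 2 := by
      simp only [sum_dual_signChar_apply, sub_eq_zero, mul_ite, mul_zero, sum_ite_eq, mem_univ,
        if_true, ← sum_mul, sq, mul_comm]

end BinarySpace

section FourDivisible

variable {V : Type*} [AddCommGroup V] [Module (ZMod 2) V] [Fintype V]

/-- The number of elements, counted with the multiplicities `e`, of a finite multiset in `V` that
lie off the hyperplane `φ = 0`. -/
def offSum (e : V → ℕ) (φ : Dual (ZMod 2) V) : ℕ := ∑ u with φ u ≠ 0, e u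

theorem offSum_add_sum_ker (e : V → ℕ) (φ : Dual (ZMod 2) V) :
    offSum e φ + ∑ u with φ u = 0, e u = ∑ u, e u := by
  rw [add_comm, offSum, sum_filter_add_sum_filter_not]

theorem two_mul_offSum (e : V → ℕ) (φ : Dual (ZMod 2) V) :
    2 * (offSum e φ : ℤ) = ∑ u, (e u : ℤ) - ∑ u, e u * signChar ℤ (φ u) := by
  simpa [offSum] using two_mul_sum_filter_ne_zero (fun u => (e u : ℤ)) φ

theorem offSum_add_offSum_add (e : V → ℕ) (φ ψ : Dual (ZMod 2) V) :
    offSum e ψ + offSum e (φ + ψ) = offSum e φ + 2 * ∑ u with φ u = 0 ∧ ψ u ≠ 0, e u := by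
  have pointwise : ∀ a b : ZMod 2, ((if b ≠ 0 then 1 else 0) + if a + b ≠ 0 then 1 else 0 : ℕ) =
      (if a ≠ 0 then 1 else 0) + 2 * if a = 0 ∧ b ≠ 0 then 1 else 0 := by decide
  simp only [offSum, sum_filter, mul_sum, ← sum_add_distrib]
  refine sum_congr rfl fun u _ => ?_
  have := congrArg (· * e u) (pointwise (φ u) (ψ u))
  simpa [add_mul, mul_assoc] using this

theorem four_mul_sum_dual_offSum_mul_sub [Fintype (Dual (ZMod 2) V)] {e : V → ℕ} (he : e 0 = 0) :
    4 * ∑ φ : Dual (ZMod 2) V, (offSum e φ : ℤ) * (offSum e φ - 4) =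
      Fintype.card V * ((∑ u, (e u : ℤ)) ^ 2 + ∑ u, (e u : ℤ) ^ 2 - 8 * ∑ u, (e u : ℤ)) := by
  have expand (φ : Dual (ZMod 2) V) : 4 * ((offSum e φ : ℤ) * (offSum e φ - 4)) =
      (∑ u, (e u : ℤ)) ^ 2 - 8 * ∑ u, (e u : ℤ) +
        (8 - 2 * ∑ u, (e u : ℤ)) * ∑ u, e u * signChar ℤ (φ u) +
        (∑ u, e u * signChar ℤ (φ u)) ^ 2 := by
    linear_combination
      (2 * (offSum e φ : ℤ) - 8 + ∑ u, (e u : ℤ) - ∑ u, e u * signChar ℤ (φ u)) *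
        two_mul_offSum e φ
  rw [mul_sum, sum_congr rfl fun φ _ => expand φ]
  simp only [sum_add_distrib, ← mul_sum, sum_dual_sum_mul_signChar fun u => (e u : ℤ),
    sum_dual_sq_sum_mul_signChar fun u => (e u : ℤ), he, sum_const, card_univ, card_dual_zmod_two]
  simp only [nsmul_eq_mul]
  ring

theorem two_dvd_sum_ker_of_four_dvd_offSum {e : V → ℕ} (hf : ∀ φ : Dual (ZMod 2) V, 4 ∣ offSum e φ)
    (φ ψ : Dual (ZMod 2) V) : 2 ∣ ∑ u with φ u = 0 ∧ ψ u ≠ 0, e u := by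
  have := offSum_add_offSum_add e φ ψ
  have := hf φ
  have := hf ψ
  have := hf (φ + ψ)
  omega

theorem sum_ker_ne_one {e : V → ℕ} (he : e 0 = 0) (hf : ∀ φ : Dual (ZMod 2) V, 4 ∣ offSum e φ)
    (φ : Dual (ZMod 2) V) : ∑ u with φ u = 0, e u ≠ 1 := by
  intro hone
  obtain ⟨u, hu, heu⟩ := exists_ne_zero_of_sum_ne_zero (hone ▸ one_ne_zero)
  rw [mem_filter_univ] at hu
  obtain ⟨ψ, hψ⟩ : ∃ ψ : Dual (ZMod 2) V, ψ u ≠ 0 := by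
    by_contra! h
    exact heu ((forall_dual_apply_eq_zero_iff (ZMod 2) u).1 h ▸ he)
  have sum_pos : 1 ≤ ∑ v with φ v = 0 ∧ ψ v ≠ 0, e v :=
    (Nat.one_le_iff_ne_zero.2 heu).trans
      (single_le_sum (fun _ _ => Nat.zero_le _) (mem_filter_univ u |>.2 ⟨hu, hψ⟩))
  have sum_le : ∑ v with φ v = 0 ∧ ψ v ≠ 0, e v ≤ ∑ v with φ v = 0, e v :=
    sum_le_sum_of_subset (monotone_filter_right _ fun _ _ h => h.1)
  have := two_dvd_sum_ker_of_four_dvd_offSum hf φ ψ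
  omega

/-- Otherwise all hyperplane complements would contain `0` or `4` elements, contradicting the sign
of the second moment. -/
theorem sum_ne_nine_of_four_dvd_offSum {e : V → ℕ} (he : e 0 = 0)
    (hf : ∀ φ : Dual (ZMod 2) V, 4 ∣ offSum e φ) : ∑ u, e u ≠ 9 := by
  intro hs
  classical
  have := FunLike.fintype (Dual (ZMod 2) V)
  have offSum_eq (φ : Dual (ZMod 2) V) : offSum e φ = 0 ∨ offSum e φ = 4 := by
    have := offSum_add_sum_ker e φ
    have := sum_ker_ne_one he hf φ
    have := hf φ
    omega
  have moment := four_mul_sum_dual_offSum_mul_sub he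
  rw [sum_eq_zero fun φ _ => by rcases offSum_eq φ with h | h <;> simp [h]] at moment
  have hs' : ∑ u, (e u : ℤ) = 9 := mod_cast hs
  have sum_sq_nonneg : 0 ≤ ∑ u, (e u : ℤ) ^ 2 := sum_nonneg fun u _ => sq_nonneg _
  have card_pos : (0 : ℤ) < Fintype.card V := mod_cast Fintype.card_pos
  rw [hs'] at moment
  nlinarith

theorem four_dvd_sq_sum_add_sum_sq (hV : Fintype.card V ∣ 32) {e : V → ℕ} (he : e 0 = 0)
    (hf : ∀ φ : Dual (ZMod 2) V, 4 ∣ offSum e φ) : 4 ∣ (∑ u, e u) ^ 2 + ∑ u, e u ^ 2 := by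
  classical
  have := FunLike.fintype (Dual (ZMod 2) V)
  have dvd_moment : (32 : ℤ) ∣ ∑ φ : Dual (ZMod 2) V, (offSum e φ : ℤ) * (offSum e φ - 4) := by
    refine dvd_sum fun φ _ => ?_
    obtain ⟨k, hk⟩ := hf φ
    obtain ⟨j, hj⟩ := Int.even_mul_pred_self k
    exact ⟨j, by rw [hk]; push_cast; linear_combination 16 * hj⟩
  have moment := four_mul_sum_dual_offSum_mul_sub he
  obtain ⟨c, hc⟩ := hV
  obtain ⟨m, hm⟩ := dvd_moment
  have card_ne_zero : (Fintype.card V : ℤ) ≠ 0 := mod_cast Fintype.card_ne_zero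
  have eq_mul : (∑ u, (e u : ℤ)) ^ 2 + ∑ u, (e u : ℤ) ^ 2 =
      4 * (c * m + 2 * ∑ u, (e u : ℤ)) := by
    apply mul_left_cancel₀ card_ne_zero
    have hc' : (32 : ℤ) = Fintype.card V * c := mod_cast hc
    linear_combination 4 * hm - moment + 4 * m * hc'
  zify
  exact ⟨_, eq_mul⟩

theorem four_dvd_sq_sum_add_card_odd (hV : Fintype.card V ∣ 32) {e : V → ℕ} (he : e 0 = 0)
    (hf : ∀ φ : Dual (ZMod 2) V, 4 ∣ offSum e φ) (hs : ∑ u, e u ≤ 9) {φ : Dual (ZMod 2) V}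
    (hodd : 5 ≤ #{u | φ u = 0 ∧ Odd (e u)}) :
    4 ∣ (∑ u, e u) ^ 2 + #{u | φ u = 0 ∧ Odd (e u)} := by
  have card_le : #{u | φ u = 0 ∧ Odd (e u)} ≤ ∑ u with φ u = 0, e u := by
    rw [← filter_filter, card_filter]
    refine sum_le_sum fun u _ => ?_
    split_ifs with h
    · exact h.pos
    · exact Nat.zero_le _
  have off_eq_zero : offSum e φ = 0 := by
    have := sum_ne_nine_of_four_dvd_offSum he hf
    have := offSum_add_sum_ker e φ
    have := hf φ
    omega
  have sum_sq_modEq : ∑ u, e u ^ 2 ≡ #{u | φ u = 0 ∧ Odd (e u)} [MOD 4] := by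
    rw [card_filter]
    refine Nat.ModEq.sum fun u _ => ?_
    by_cases hu : φ u = 0
    · rcases Nat.even_or_odd (e u) with h | h
      · simpa [hu, Nat.not_odd_iff_even.2 h] using
          Nat.modEq_zero_iff_dvd.2 (pow_dvd_pow_of_dvd h.two_dvd 2)
      · simpa [hu, h] using (Nat.modEq_iff_dvd' (Nat.one_le_pow _ _ h.pos)).2
          ((by simp : 4 ∣ 8).trans (Nat.eight_dvd_sq_sub_one_of_odd h)) |>.symm
    · have : e u = 0 := sum_eq_zero_iff.1 off_eq_zero u (mem_filter_univ u |>.2 hu)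
      simp [this, Nat.ModEq]
  exact ((sum_sq_modEq.add_left _).dvd_iff dvd_rfl).1 (four_dvd_sq_sum_add_sum_sq hV he hf)

end FourDivisible

section GaussSum

/-- Substituting `v = u + z` in the double sum turns the inner sum over `u` into a sum of a
nontrivial character, unless `z = 0`. -/
theorem sum_mul_star_sum_of_map_add {V R : Type*} [AddCommGroup V] [Fintype V] [CommRing R]
    [IsDomain R] [StarRing R] {f : V → R} {b : V → AddChar V R}
    (hf : ∀ z u, f (u + z) = f u * f z * b z u) (hb : ∀ z ≠ 0, b z ≠ 0)
    (hnorm : ∀ u, f u * star (f u) = 1) :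
    (∑ u, f u) * star (∑ u, f u) = Fintype.card V := by
  classical
  have inner_sum (z : V) (hz : z ≠ 0) : ∑ u, f (u + z) * star (f u) = 0 := by
    calc ∑ u, f (u + z) * star (f u)
      _ = f z * ∑ u, b z u := by
        rw [mul_sum]
        refine sum_congr rfl fun u _ => ?_
        linear_combination star (f u) * hf z u + f z * b z u * hnorm u
      _ = 0 := by rw [AddChar.sum_eq_ite, if_neg (hb z hz), mul_zero]
  calc (∑ u, f u) * star (∑ u, f u)
    _ = ∑ u, ∑ v, f v * star (f u) := by
      rw [star_sum, mul_comm, sum_mul_sum]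
      simp only [mul_comm]
    _ = ∑ u, ∑ z, f (u + z) * star (f u) :=
      sum_congr rfl fun u _ => (Equiv.sum_comp (Equiv.addLeft u) (f · * star (f u))).symm
    _ = ∑ z, ∑ u, f (u + z) * star (f u) := sum_comm
    _ = ∑ u, f (u + 0) * star (f u) := Fintype.sum_eq_single 0 inner_sum
    _ = Fintype.card V := by simp [hnorm]

end GaussSum

section WeightDistribution

theorem sum_I_pow {α : Type*} [Fintype α] (w : α → ℕ) : ∑ u, Complex.I ^ w u =
    (#{u | w u % 4 = 0} - #{u | w u % 4 = 2} : ℝ) +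
      (#{u | w u % 4 = 1} - #{u | w u % 4 = 3} : ℝ) * Complex.I := by
  have I_pow (n : ℕ) : Complex.I ^ n =
      ((if n % 4 = 0 then 1 else 0) - if n % 4 = 2 then 1 else 0) +
        ((if n % 4 = 1 then 1 else 0) - if n % 4 = 3 then 1 else 0) * Complex.I := by
    rw [Complex.I_pow_eq_pow_mod]
    have : n % 4 < 4 := n.mod_lt (by simp)
    interval_cases n % 4 <;> simp
  simp only [I_pow, sum_add_distrib, sum_sub_distrib, ← sum_mul, sum_boole]
  push_cast
  rfl

/-- An encoder, that is a linear map `G` onto a code of length `#ι`, is LCD if the Gram form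
`(u, v) ↦ G u ⬝ᵥ G v` is nondegenerate. This says that `G` is injective and that its range meets
its dual code trivially. -/
def IsLCDEncoder {F V ι : Type*} [Field F] [AddCommGroup V] [Module F V] [Fintype ι]
    (G : V →ₗ[F] ι → F) : Prop :=
  ∀ u ≠ 0, ∃ v, G u ⬝ᵥ G v ≠ 0

variable {V ι : Type*} [AddCommGroup V] [Module (ZMod 2) V] [Fintype ι]
  {G : V →ₗ[ZMod 2] ι → ZMod 2}

/-- The sum of all coordinates of the codeword `G u`, as a functional of `u`. -/
def parityCheck (G : V →ₗ[ZMod 2] ι → ZMod 2) : Dual (ZMod 2) V :=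
  ∑ i, LinearMap.proj i ∘ₗ G

theorem parityCheck_apply (G : V →ₗ[ZMod 2] ι → ZMod 2) (u : V) :
    parityCheck G u = (hammingNorm (G u) : ZMod 2) := by
  simp [parityCheck, ← sum_eq_hammingNorm]

theorem I_pow_hammingNorm_add (x y : ι → ZMod 2) :
    Complex.I ^ hammingNorm (x + y) =
      Complex.I ^ hammingNorm x * Complex.I ^ hammingNorm y * signChar ℂ (x ⬝ᵥ y) := by
  rw [← pow_add, ← hammingNorm_add_add_two_mul_card, dotProduct_eq_card, signChar_natCast, pow_add,
    pow_mul, Complex.I_sq, mul_assoc, ← mul_pow, neg_one_mul, neg_neg, one_pow, mul_one]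

variable [Fintype V]

theorem IsLCDEncoder.sq_sub_add_sq_sub (hG : IsLCDEncoder G) :
    (#{u | hammingNorm (G u) % 4 = 0} - #{u | hammingNorm (G u) % 4 = 2} : ℤ) ^ 2 +
      (#{u | hammingNorm (G u) % 4 = 1} - #{u | hammingNorm (G u) % 4 = 3} : ℤ) ^ 2 =
      Fintype.card V := by
  let gramChar (z : V) : AddChar V ℂ :=
    (signChar ℂ).compAddMonoidHom
      (dotProductBilin (ZMod 2) (ZMod 2) (G z) ∘ₗ G).toAddMonoidHom
  have gauss := sum_mul_star_sum_of_map_add (f := fun u => Complex.I ^ hammingNorm (G u))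
    (b := gramChar) (fun z u => ?_) (fun z hz => ?_) fun u => ?_
  · rw [sum_I_pow, Complex.star_def, Complex.mul_conj, Complex.normSq_add_mul_I] at gauss
    exact mod_cast gauss
  · rw [add_comm, map_add, I_pow_hammingNorm_add, mul_comm (Complex.I ^ _)]
    rfl
  · obtain ⟨v, hv⟩ := hG z hz
    refine AddChar.ne_one_iff.2 ⟨v, ?_⟩
    have : gramChar z v = -1 := (signChar_eq_ite ℂ _).trans (if_neg hv)
    norm_num [this]
  · simp [← mul_pow]

theorem card_ker_parityCheck (G : V →ₗ[ZMod 2] ι → ZMod 2) :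
    #{u | parityCheck G u = 0} =
      #{u | hammingNorm (G u) % 4 = 0} + #{u | hammingNorm (G u) % 4 = 2} := by
  simp only [card_filter, ← sum_add_distrib]
  refine sum_congr rfl fun u _ => ?_
  simp only [parityCheck_apply, ZMod.natCast_eq_zero_iff]
  split_ifs <;> omega

end WeightDistribution

section Excess

variable {V ι : Type*} [AddCommGroup V] [Module (ZMod 2) V] [Fintype ι]
  {G : V →ₗ[ZMod 2] ι → ZMod 2}

/-- Half the excess of the weight of `G u` over `d`, rounded down. The truncated subtraction makes
it `0` at `u = 0`. -/
def excess (G : V →ₗ[ZMod 2] ι → ZMod 2) (d : ℕ) (u : V) : ℕ := (hammingNorm (G u) - d) / 2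

theorem excess_zero (G : V →ₗ[ZMod 2] ι → ZMod 2) (d : ℕ) : excess G d 0 = 0 := by
  simp [excess]

theorem odd_excess_iff {d : ℕ} {u : V} (hu : u ≠ 0 → d ≤ hammingNorm (G u)) :
    parityCheck G u = 0 ∧ Odd (excess G d u) ↔
      u ≠ 0 ∧ hammingNorm (G u) % 4 = (2 * ((d + 1) / 2) + 2) % 4 := by
  rw [parityCheck_apply, ZMod.natCast_eq_zero_iff, Nat.odd_iff]
  rcases eq_or_ne u 0 with rfl | h
  · simp [excess]
  · have := hu h
    rw [and_iff_right h, excess]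
    omega

end Excess

section DimensionFive

theorem eq_four_or_eq_neg_four_of_sq_add_sq {a b : ℤ} (h : a ^ 2 + b ^ 2 = 32) :
    a = 4 ∨ a = -4 := by
  obtain ⟨_, _⟩ : -6 < a ∧ a < 6 := abs_lt.1 (abs_lt_of_sq_lt_sq (by nlinarith) (by simp))
  obtain ⟨_, _⟩ : -6 < b ∧ b < 6 := abs_lt.1 (abs_lt_of_sq_lt_sq (by nlinarith) (by simp))
  interval_cases a <;> interval_cases b <;> simp_all

variable {V ι : Type*} [AddCommGroup V] [Module (ZMod 2) V] [Fintype V] [Fintype ι]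
  {G : V →ₗ[ZMod 2] ι → ZMod 2}

theorem two_mul_card_ker {φ : Dual (ZMod 2) V} (hφ : φ ≠ 0) :
    2 * #{u | φ u = 0} = Fintype.card V := by
  have sum_eq_zero := sum_signChar_apply φ
  simp only [hφ, if_false, signChar_eq_ite, sum_ite, sum_const, nsmul_eq_mul] at sum_eq_zero
  have := card_filter_add_card_filter_not (s := univ) (φ · = 0)
  rw [card_univ] at this
  lia

theorem IsLCDEncoder.parityCheck_ne_zero (hG : IsLCDEncoder G) (hV : Fintype.card V = 32) :
    parityCheck G ≠ 0 := by
  intro h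
  have even_weight (u : V) : hammingNorm (G u) % 2 = 0 := by
    have := parityCheck_apply G u
    rw [h, LinearMap.zero_apply, eq_comm, ZMod.natCast_eq_zero_iff] at this
    omega
  have card_eq_zero {r : ℕ} (hr : r % 2 = 1) : #{u | hammingNorm (G u) % 4 = r} = 0 := by
    rw [card_eq_zero, filter_eq_empty_iff]
    intro u _
    have := even_weight u
    omega
  have sum_sq := hG.sq_sub_add_sq_sub
  rw [hV, add_comm] at sum_sq
  have := eq_four_or_eq_neg_four_of_sq_add_sq sum_sq
  rw [card_eq_zero (by simp), card_eq_zero (by simp)] at this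
  omega

theorem IsLCDEncoder.card_hammingNorm_mod_four (hG : IsLCDEncoder G) (hV : Fintype.card V = 32) :
    #{u | hammingNorm (G u) % 4 = 0} = 10 ∧ #{u | hammingNorm (G u) % 4 = 2} = 6 ∨
      #{u | hammingNorm (G u) % 4 = 0} = 6 ∧ #{u | hammingNorm (G u) % 4 = 2} = 10 := by
  have sum_sq := hG.sq_sub_add_sq_sub
  have two_mul_card := two_mul_card_ker (hG.parityCheck_ne_zero hV)
  rw [hV] at sum_sq two_mul_card
  rw [card_ker_parityCheck] at two_mul_card
  have := eq_four_or_eq_neg_four_of_sq_add_sq sum_sq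
  omega

/-- With `D = (d + 1) / 2`, the elements counted are the nonzero `u` for which `G u` has weight
`2 * D + 2` modulo `4`. -/
theorem IsLCDEncoder.card_odd_excess (hG : IsLCDEncoder G) (hV : Fintype.card V = 32) {d : ℕ}
    (hd : ∀ u ≠ 0, d ≤ hammingNorm (G u)) :
    5 ≤ #{u | parityCheck G u = 0 ∧ Odd (excess G d u)} ∧
      #{u | parityCheck G u = 0 ∧ Odd (excess G d u)} % 4 = 2 - (d + 1) / 2 % 2 := by
  classical
  have card_eq : #{u | parityCheck G u = 0 ∧ Odd (excess G d u)} =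
      #(({u | hammingNorm (G u) % 4 = (2 * ((d + 1) / 2) + 2) % 4} : Finset V).erase 0) := by
    congr 1
    ext u
    simp [odd_excess_iff (hd u)]
  have weights := hG.card_hammingNorm_mod_four hV
  rw [card_eq, card_erase_eq_ite]
  rcases Nat.mod_two_eq_zero_or_one ((d + 1) / 2) with h | h
  · rw [show (2 * ((d + 1) / 2) + 2) % 4 = 2 by omega, h, if_neg (by simp)]
    omega
  · rw [show (2 * ((d + 1) / 2) + 2) % 4 = 0 by omega, h, if_pos (by simp)]
    omega

end DimensionFive

section UpperBound

variable {V ι : Type*} [AddCommGroup V] [Module (ZMod 2) V] [Fintype ι]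
  {G : V →ₗ[ZMod 2] ι → ZMod 2}

theorem four_mul_excess [DecidableEq V] {d : ℕ} {u : V} (hu : u ≠ 0 → d ≤ hammingNorm (G u)) :
    4 * (excess G d u : ℤ) = 2 * hammingNorm (G u) - (2 * d + 1) +
      (-1) ^ d * signChar ℤ (parityCheck G u) +
        if u = 0 then (2 * d + 1 - (-1) ^ d : ℤ) else 0 := by
  rcases eq_or_ne u 0 with rfl | h
  · simp [excess]
  · obtain ⟨m, hm⟩ := Nat.exists_eq_add_of_le (hu h)
    rw [parityCheck_apply, signChar_natCast, ← pow_add, if_neg h, excess, hm,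
      Nat.add_sub_cancel_left, ← add_assoc, pow_add, Even.neg_one_pow ⟨d, rfl⟩, one_mul]
    rcases Nat.even_or_odd' m with ⟨k, rfl | rfl⟩
    · rw [Nat.mul_div_cancel_left k two_pos, Even.neg_one_pow (by simp)]
      push_cast
      ring
    · rw [show (2 * k + 1) / 2 = k by omega, Odd.neg_one_pow (by simp)]
      push_cast
      ring

variable [Fintype V]

open Classical in
theorem sum_signChar_apply_mul (φ ψ : Dual (ZMod 2) V) :
    ∑ u, signChar ℤ (φ u) * signChar ℤ (ψ u) = if φ = ψ then (Fintype.card V : ℤ) else 0 := by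
  simpa [AddChar.map_add_eq_mul, add_eq_zero_iff_eq_neg, ZModModule.neg_eq_self] using
    sum_signChar_apply (φ + ψ)

open Classical in
theorem two_mul_sum_hammingNorm_mul_signChar (G : V →ₗ[ZMod 2] ι → ZMod 2)
    (φ : Dual (ZMod 2) V) :
    2 * ∑ u, (hammingNorm (G u) : ℤ) * signChar ℤ (φ u) = Fintype.card V *
      ((if φ = 0 then (Fintype.card ι : ℤ) else 0) - #{i | LinearMap.proj i ∘ₗ G = φ}) := by
  have sum_coord (i : ι) : ∑ u, signChar ℤ (G u i) * signChar ℤ (φ u) =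
      if LinearMap.proj i ∘ₗ G = φ then (Fintype.card V : ℤ) else 0 := by
    simp only [← sum_signChar_apply_mul, LinearMap.comp_apply, LinearMap.proj_apply]
  calc 2 * ∑ u, (hammingNorm (G u) : ℤ) * signChar ℤ (φ u)
    _ = ∑ u, (Fintype.card ι * signChar ℤ (φ u) - ∑ i, signChar ℤ (G u i) * signChar ℤ (φ u)) := by
      rw [mul_sum]
      simp only [← mul_assoc, two_mul_hammingNorm, sub_mul, sum_mul]
    _ = _ := by
      rw [sum_sub_distrib, ← mul_sum, sum_signChar_apply, sum_comm,
        sum_congr rfl fun i _ => sum_coord i, ← sum_filter, sum_const, nsmul_eq_mul, mul_sub,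
        mul_ite, mul_ite, mul_zero, mul_zero, mul_comm, mul_comm (#_ : ℤ)]

open Classical in
theorem four_mul_sum_excess_mul_signChar {d : ℕ} (hd : ∀ u ≠ 0, d ≤ hammingNorm (G u))
    (φ : Dual (ZMod 2) V) :
    4 * ∑ u, (excess G d u : ℤ) * signChar ℤ (φ u) = Fintype.card V *
      ((if φ = 0 then Fintype.card ι - (2 * d + 1 : ℤ) else 0) -
        #{i | LinearMap.proj i ∘ₗ G = φ} + if parityCheck G = φ then (-1) ^ d else 0) +
      (2 * d + 1 - (-1) ^ d) := by
  have expand (u : V) : 4 * ((excess G d u : ℤ) * signChar ℤ (φ u)) =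
      2 * (hammingNorm (G u) * signChar ℤ (φ u)) - (2 * d + 1) * signChar ℤ (φ u) +
        (-1) ^ d * (signChar ℤ (parityCheck G u) * signChar ℤ (φ u)) +
        (if u = 0 then (2 * d + 1 - (-1) ^ d : ℤ) else 0) * signChar ℤ (φ u) := by
    linear_combination signChar ℤ (φ u) * four_mul_excess (hd u)
  rw [mul_sum, sum_congr rfl fun u _ => expand u]
  simp only [sum_add_distrib, sum_sub_distrib, ← mul_sum, sum_signChar_apply_mul, sum_ite_eq',
    mem_univ, if_true, map_zero, AddChar.map_zero_eq_one,
    two_mul_sum_hammingNorm_mul_signChar, sum_signChar_apply, ite_mul, zero_mul, mul_one]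
  split_ifs <;> ring

theorem four_dvd_offSum_excess (hV : 32 ∣ Fintype.card V) {d : ℕ} (h : parityCheck G ≠ 0)
    (hd : ∀ u ≠ 0, d ≤ hammingNorm (G u)) (φ : Dual (ZMod 2) V) : 4 ∣ offSum (excess G d) φ := by
  classical
  rcases eq_or_ne φ 0 with rfl | hφ
  · simp [offSum]
  have at_zero := four_mul_sum_excess_mul_signChar hd 0
  have at_φ := four_mul_sum_excess_mul_signChar hd φ
  have two_mul_off := two_mul_offSum (excess G d) φ
  obtain ⟨c, hc⟩ := hV
  simp only [LinearMap.zero_apply, AddChar.map_zero_eq_one, mul_one, if_true, h, if_false, hφ, hc]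
    at at_zero at_φ
  push_cast at at_zero at_φ
  zify
  have off_eq : 8 * (offSum (excess G d) φ : ℤ) = 8 * (4 * (c *
      (Fintype.card ι - (2 * d + 1) - #{i | LinearMap.proj i ∘ₗ G = 0} +
        #{i | LinearMap.proj i ∘ₗ G = φ} - if parityCheck G = φ then (-1) ^ d else 0))) := by
    linear_combination 4 * two_mul_off + at_zero - at_φ
  exact ⟨_, mul_left_cancel₀ (by simp) off_eq⟩

open Classical in
theorem four_mul_sum_excess (h : parityCheck G ≠ 0) {d : ℕ}
    (hd : ∀ u ≠ 0, d ≤ hammingNorm (G u)) :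
    4 * ∑ u, (excess G d u : ℤ) =
      Fintype.card V * (Fintype.card ι - (2 * d + 1) - #{i | LinearMap.proj i ∘ₗ G = 0}) +
        (2 * d + 1 - (-1) ^ d) := by
  simpa [h] using four_mul_sum_excess_mul_signChar hd 0

theorem IsLCDEncoder.mul_add_le (hG : IsLCDEncoder G) (hV : Fintype.card V = 32) {d : ℕ}
    (hd : ∀ u ≠ 0, d ≤ hammingNorm (G u)) : 31 * d + 35 ≤ 16 * Fintype.card ι := by
  classical
  by_contra! short
  have parityCheck_ne := hG.parityCheck_ne_zero hV
  have four_mul_sum := four_mul_sum_excess parityCheck_ne hd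
  obtain ⟨sum_le, sum_mod⟩ :
      ∑ u, excess G d u ≤ 9 ∧ (∑ u, excess G d u) % 2 = (d + 1) / 2 % 2 := by
    rw [← Nat.cast_sum, hV] at four_mul_sum
    rcases Nat.even_or_odd d with even | odd
    · rw [even.neg_one_pow] at four_mul_sum
      rw [Nat.even_iff] at even
      omega
    · rw [odd.neg_one_pow] at four_mul_sum
      rw [Nat.odd_iff] at odd
      omega
  obtain ⟨five_le, card_mod⟩ := hG.card_odd_excess hV hd
  have four_dvd := four_dvd_sq_sum_add_card_odd hV.dvd (excess_zero G d)
    (four_dvd_offSum_excess hV.symm.dvd parityCheck_ne hd) sum_le five_le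
  rcases Nat.mod_two_eq_zero_or_one (∑ u, excess G d u) with h | h
  · obtain ⟨k, hk⟩ := pow_dvd_pow_of_dvd (Nat.dvd_of_mod_eq_zero h) 2
    omega
  · obtain ⟨k, hk⟩ := Nat.eight_dvd_sq_sub_one_of_odd (Nat.odd_iff.2 h)
    have := (Nat.odd_iff.2 h).pow (n := 2) |>.pos
    omega

end UpperBound

section Codes

variable {F : Type*} [Field F] {n : ℕ}

theorem IsLCD.isLCDEncoder_subtype {C : Submodule F (Fin n → F)} (hC : IsLCD C) :
    IsLCDEncoder C.subtype := by
  intro u hu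
  by_contra! h
  have : (u : Fin n → F) ∈ C ⊓ dualCode C := ⟨u.2, fun y hy => h ⟨y, hy⟩⟩
  rw [hC, Submodule.mem_bot, ZeroMemClass.coe_eq_zero] at this
  exact hu this

theorem minWeight_le_hammingNorm [DecidableEq F] {C : Submodule F (Fin n → F)} {x : Fin n → F}
    (hx : x ∈ C) (hx0 : x ≠ 0) : minWeight C ≤ hammingNorm x :=
  Nat.sInf_le ⟨x, hx, hx0, rfl⟩

theorem le_minWeight [DecidableEq F] {C : Submodule F (Fin n → F)} (hC : C ≠ ⊥) {d : ℕ}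
    (hd : ∀ x ∈ C, x ≠ 0 → d ≤ hammingNorm x) : d ≤ minWeight C := by
  obtain ⟨y, hy, hy0⟩ := C.exists_mem_ne_zero_of_ne_bot hC
  refine le_csInf ⟨_, y, hy, hy0, rfl⟩ ?_
  rintro _ ⟨x, hx, hx0, rfl⟩
  exact hd x hx hx0

theorem IsLCD.mul_minWeight_add_le {C : Submodule (ZMod 2) (Fin n → ZMod 2)} (hC : IsLCD C)
    (hk : finrank (ZMod 2) C = 5) : 31 * minWeight C + 35 ≤ 16 * n := by
  have := Fintype.ofFinite C
  have card_eq : Fintype.card C = 32 := by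
    rw [card_eq_pow_finrank (K := ZMod 2), hk, ZMod.card]
    rfl
  simpa using hC.isLCDEncoder_subtype.mul_add_le card_eq fun u hu =>
    minWeight_le_hammingNorm u.2 (by simpa using hu)

end Codes

section GeneratorMatrices

open Matrix

variable {F ι : Type*} [Field F] [Fintype ι] {n k d : ℕ}

theorem IsLCDEncoder.injective {V : Type*} [AddCommGroup V] [Module F V] {G : V →ₗ[F] ι → F}
    (hG : IsLCDEncoder G) : Function.Injective G := by
  refine (injective_iff_map_eq_zero G).2 fun u hu => ?_
  by_contra hu0
  obtain ⟨v, hv⟩ := hG u hu0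
  simp [hu] at hv

theorem IsLCDEncoder.isLCD_range {V : Type*} [AddCommGroup V] [Module F V]
    {G : V →ₗ[F] Fin n → F} (hG : IsLCDEncoder G) : IsLCD (LinearMap.range G) := by
  rw [IsLCD, eq_bot_iff]
  rintro _ ⟨⟨u, rfl⟩, hu⟩
  by_contra hne
  obtain ⟨v, hv⟩ := hG u fun h => hne (by simp [h])
  exact hv (hu _ ⟨v, rfl⟩)

theorem isLCDEncoder_mulVecLin {M : Matrix ι (Fin k) F} (hM : (Mᵀ * M).det ≠ 0) :
    IsLCDEncoder M.mulVecLin := by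
  intro u hu
  obtain ⟨v, hv⟩ := (nondegenerate_of_det_ne_zero hM).exists_not_ortho_of_ne_zero hu
  refine ⟨v, ?_⟩
  rwa [← mulVec_mulVec, dotProduct_mulVec, vecMul_transpose] at hv

theorem hammingNorm_comp_equiv {κ : Type*} [Fintype κ] [DecidableEq F] (e : κ ≃ ι) (x : ι → F) :
    hammingNorm (x ∘ e) = hammingNorm x :=
  card_equiv e (by simp)

/-- Massey's criterion: a generator matrix, here with the codewords as combinations of its columns,
yields an LCD code as soon as its Gram matrix is invertible. -/
theorem exists_isLCD_of_det_ne_zero [DecidableEq F] [NeZero k] (hn : Fintype.card ι = n)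
    (M : Matrix ι (Fin k) F) (hM : (Mᵀ * M).det ≠ 0) (hd : ∀ u ≠ 0, d ≤ hammingNorm (M *ᵥ u)) :
    ∃ C : Submodule F (Fin n → F), finrank F C = k ∧ IsLCD C ∧ d ≤ minWeight C := by
  let e := (Fintype.equivFinOfCardEq hn).symm
  have encoder : IsLCDEncoder (M.submatrix e id).mulVecLin :=
    isLCDEncoder_mulVecLin (by rwa [transpose_submatrix, submatrix_mul_equiv, submatrix_id_id])
  have finrank_eq : finrank F (LinearMap.range (M.submatrix e id).mulVecLin) = k := by
    rw [LinearMap.finrank_range_of_inj encoder.injective, finrank_fin_fun]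
  refine ⟨_, finrank_eq, encoder.isLCD_range, le_minWeight ?_ ?_⟩
  · rw [← Submodule.one_le_finrank_iff, finrank_eq]
    exact NeZero.one_le
  · rintro _ ⟨u, rfl⟩ hu
    have : M.submatrix e id *ᵥ u = (M *ᵥ u) ∘ e := rfl
    rw [mulVecLin_apply, this, hammingNorm_comp_equiv]
    exact hd u fun h => hu (by simp [h])

theorem hammingNorm_sumElim {κ : Type*} [Fintype κ] [DecidableEq F] (x : ι → F) (y : κ → F) :
    hammingNorm (Sum.elim x y) = hammingNorm x + hammingNorm y := by
  simp only [hammingNorm, card_filter, Fintype.sum_sum_type, Sum.elim_inl, Sum.elim_inr]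
  rfl

end GeneratorMatrices

section Simplex

open Matrix

theorem transpose_mul_self_eq_zero_of_four_dvd {ι κ : Type*} [Fintype ι] [Fintype κ]
    {B : Matrix ι κ (ZMod 2)} (hB : ∀ u, 4 ∣ hammingNorm (B *ᵥ u)) :
    Bᵀ * B = 0 := by
  classical
  ext i j
  have := dotProduct_eq_zero_of_four_dvd (hB (Pi.single i 1)) (hB (Pi.single j 1))
    (by rw [← mulVec_add]; exact hB _)
  rwa [mulVec_single_one, mulVec_single_one] at this

/-- A generator matrix of the `q`-fold repetition of the simplex code of dimension `k`: its rows are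
the nonzero vectors, each repeated `q` times. -/
def simplexMatrix (q k : ℕ) : Matrix (Fin q × {v : Fin k → ZMod 2 // v ≠ 0}) (Fin k) (ZMod 2) :=
  of fun i => i.2

theorem card_simplexMatrix_rows (q k : ℕ) :
    Fintype.card (Fin q × {v : Fin k → ZMod 2 // v ≠ 0}) = q * (2 ^ k - 1) := by
  simp [Fintype.card_subtype_compl]

theorem two_mul_hammingNorm_simplexMatrix (q : ℕ) {k : ℕ} {u : Fin k → ZMod 2} (hu : u ≠ 0) :
    2 * hammingNorm (simplexMatrix q k *ᵥ u) = q * 2 ^ k := by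
  have sum_all : ∑ v : Fin k → ZMod 2, signChar ℤ (v ⬝ᵥ u) = 0 := by
    have := sum_signChar_apply (dotProductEquiv (ZMod 2) (Fin k) u)
    rw [if_neg (by simpa using hu)] at this
    simpa [dotProduct_comm] using this
  have sum_ne_zero : ∑ v : {v : Fin k → ZMod 2 // v ≠ 0}, signChar ℤ (v ⬝ᵥ u) = -1 := by
    rw [← sum_subtype (univ.erase 0) (by simp) fun v => signChar ℤ (v ⬝ᵥ u),
      sum_erase_eq_sub (mem_univ 0), sum_all, zero_dotProduct, AddChar.map_zero_eq_one, zero_sub]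
  have sum_coord : ∑ i, signChar ℤ ((simplexMatrix q k *ᵥ u) i) = -q := by
    simp [Fintype.sum_prod_type, simplexMatrix, mulVec, sum_ne_zero]
  have two_mul := two_mul_hammingNorm (simplexMatrix q k *ᵥ u)
  rw [card_simplexMatrix_rows, sum_coord] at two_mul
  zify
  rw [two_mul]
  push_cast [Nat.one_le_two_pow]
  ring

theorem four_dvd_hammingNorm_simplexMatrix (q : ℕ) {k : ℕ} (hk : 3 ≤ k) (u : Fin k → ZMod 2) :
    4 ∣ hammingNorm (simplexMatrix q k *ᵥ u) := by
  rcases eq_or_ne u 0 with rfl | hu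
  · simp
  · have := two_mul_hammingNorm_simplexMatrix q hu
    have : 2 * 4 ∣ 2 * hammingNorm (simplexMatrix q k *ᵥ u) :=
      this ▸ (pow_dvd_pow 2 hk).mul_left q
    exact Nat.dvd_of_mul_dvd_mul_left two_pos this

theorem exists_isLCD_add_simplex {ι : Type*} [Fintype ι] {k d : ℕ} (hk : 3 ≤ k)
    {M : Matrix ι (Fin k) (ZMod 2)} (hM : (Mᵀ * M).det ≠ 0)
    (hd : ∀ u ≠ 0, d ≤ hammingNorm (M *ᵥ u)) {n q : ℕ}
    (hn : Fintype.card ι + q * (2 ^ k - 1) = n) :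
    ∃ C : Submodule (ZMod 2) (Fin n → ZMod 2),
      finrank (ZMod 2) C = k ∧ IsLCD C ∧ d + q * 2 ^ (k - 1) ≤ minWeight C := by
  have : NeZero k := ⟨by omega⟩
  refine exists_isLCD_of_det_ne_zero ?_ (M.fromRows (simplexMatrix q k)) ?_ fun u hu => ?_
  · rwa [Fintype.card_sum, card_simplexMatrix_rows]
  · rwa [transpose_fromRows, fromCols_mul_fromRows,
      transpose_mul_self_eq_zero_of_four_dvd (four_dvd_hammingNorm_simplexMatrix q hk), add_zero]
  · have two_mul := two_mul_hammingNorm_simplexMatrix q hu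
    rw [← mul_pow_sub_one (NeZero.ne k) 2, mul_left_comm] at two_mul
    rw [fromRows_mulVec, hammingNorm_sumElim]
    exact add_le_add (hd u hu) (Nat.eq_of_mul_eq_mul_left two_pos two_mul).ge

end Simplex

section DimensionFiveCodes

open Matrix

/-- The matrix whose rows are the five-digit binary expansions of the entries of `r`, least
significant digit first. -/
def binaryMatrix (r : List ℕ) : Matrix (Fin r.length) (Fin 5) (ZMod 2) :=
  of fun i j => if r[i].testBit j then 1 else 0

/-- Rows, in binary, of generator matrices of optimal LCD codes of dimension `5`, one for each
residue class of lengths modulo `31` in the theorem. -/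
def optimalRows : List (List ℕ) := [
  [3, 4, 5, 19, 25, 26],
  [6, 7, 13, 16, 17, 19, 21, 25, 28],
  [2, 3, 6, 7, 9, 10, 11, 12, 17, 18, 25, 28, 31],
  [1, 7, 11, 13, 14, 15, 16, 18, 20, 24, 25, 26, 28, 29, 31],
  [1, 2, 3, 4, 6, 7, 8, 9, 13, 15, 16, 20, 21, 22, 25, 28, 30],
  [1, 1, 3, 3, 4, 6, 8, 10, 15, 16, 18, 19, 21, 22, 23, 24, 26, 27, 29, 29, 31],
  [3, 4, 5, 8, 8, 9, 9, 11, 11, 14, 15, 16, 17, 18, 19, 21, 25, 27, 28, 29, 30, 31, 31],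
  [1, 2, 4, 5, 6, 7, 8, 9, 10, 11, 12, 14, 15, 18, 20, 22, 23, 25, 26, 27, 28, 29, 30, 31],
  [2, 3, 5, 6, 6, 7, 8, 11, 12, 12, 13, 13, 15, 15, 16, 16, 17, 18, 19, 24, 25, 26, 26, 27, 30],
  [1, 2, 4, 5, 5, 6, 7, 8, 10, 10, 11, 12, 12, 14, 15, 16, 17, 19, 20, 23, 24, 25, 26, 27, 28, 29,
    30],
  [1, 2, 3, 5, 6, 7, 8, 10, 11, 12, 13, 14, 14, 15, 17, 19, 21, 22, 23, 24, 25, 26, 27, 28, 28, 29,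
    30, 31],
  [1, 1, 2, 4, 5, 6, 7, 7, 8, 10, 12, 12, 14, 15, 16, 17, 18, 19, 20, 21, 22, 22, 24, 27, 27, 29,
    30, 30, 31],
  [1, 2, 2, 3, 4, 5, 7, 8, 9, 10, 11, 12, 13, 14, 15, 16, 17, 17, 18, 20, 21, 22, 23, 24, 25, 27,
    29, 30, 31, 31],
  [4, 5, 6, 7, 8, 9, 9, 10, 12, 12, 13, 14, 14, 15, 16, 17, 19, 19, 23, 24, 24, 25, 26, 26, 27, 27,
    28, 28, 29, 30, 31],
  [1, 2, 2, 3, 4, 5, 6, 7, 7, 9, 10, 11, 12, 13, 14, 15, 15, 16, 17, 18, 19, 20, 21, 23, 24, 25, 26,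
    27, 28, 30, 31, 31]]

theorem det_gram_binaryMatrix_ne_zero :
    ∀ r ∈ optimalRows, ((binaryMatrix r)ᵀ * binaryMatrix r).det ≠ 0 := by
  have mulVec_ne_zero : ∀ r ∈ optimalRows, ∀ u ≠ 0,
      ((binaryMatrix r)ᵀ * binaryMatrix r) *ᵥ u ≠ 0 := by
    decide +kernel
  intro r hr
  rw [Ne, ← exists_mulVec_eq_zero_iff]
  exact fun ⟨u, hu, h⟩ => mulVec_ne_zero r hr u hu h

theorem le_hammingNorm_binaryMatrix : ∀ r ∈ optimalRows, ∀ u ≠ 0,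
    (16 * r.length - 35) / 31 ≤ hammingNorm (binaryMatrix r *ᵥ u) := by
  decide +kernel

theorem exists_mem_optimalRows : ∀ t ∈ ({0, 1, 6, 9, 13, 15, 17, 21, 23, 24, 25, 27, 28, 29, 30} :
    Finset ℕ), ∃ r ∈ optimalRows, 6 ≤ r.length ∧ r.length ≤ 32 ∧ r.length ≡ t [MOD 31] := by
  decide +kernel

theorem largestLCDMinWeight_eq_of_exists {n : ℕ}
    (h : ∃ C : Submodule (ZMod 2) (Fin n → ZMod 2),
      finrank (ZMod 2) C = 5 ∧ IsLCD C ∧ (16 * n - 35) / 31 ≤ minWeight C) :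
    largestLCDMinWeight (ZMod 2) n 5 = (16 * n - 35) / 31 := by
  obtain ⟨C, hk, hC, hd⟩ := h
  obtain ⟨⟨C', hk', hC', hd'⟩, is_max⟩ := isGreatest_largestLCDMinWeight ⟨_, C, hk, hC, rfl⟩
  have lower := is_max ⟨C, hk, hC, rfl⟩
  have upper := hC'.mul_minWeight_add_le hk'
  omega

theorem largestLCDMinWeight_five {n t : ℕ} (hn : 5 ≤ n)
    (ht : t ∈ ({0, 1, 6, 9, 13, 15, 17, 21, 23, 24, 25, 27, 28, 29, 30} : Finset ℕ))
    (h : n ≡ t [MOD 31]) : largestLCDMinWeight (ZMod 2) n 5 = (16 * n - 35) / 31 := by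
  obtain ⟨r, hr, ge, le, length_modEq⟩ := exists_mem_optimalRows t ht
  obtain ⟨q, hq⟩ : ∃ q, r.length + q * 31 = n := by
    have := h.trans length_modEq.symm
    exact ⟨(n - r.length) / 31, by unfold Nat.ModEq at this; omega⟩
  obtain ⟨C, hk, hC, hd⟩ := exists_isLCD_add_simplex (n := n) (q := q) (by simp)
    (det_gram_binaryMatrix_ne_zero r hr) (le_hammingNorm_binaryMatrix r hr) (by simpa using hq)
  refine largestLCDMinWeight_eq_of_exists ⟨C, hk, hC, ?_⟩
  omega

end DimensionFiveCodes

theorem mainTheorem1 (n : ℕ) (hn : 5 ≤ n) :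
    ((∃ t ∈ ({1, 9, 13, 15, 17, 21, 23, 24, 25, 27, 28, 29, 30} : Finset ℕ), n ≡ t [MOD 31]) →
      (largestLCDMinWeight (ZMod 2) n 5 : ℤ) = ⌊(16 * n : ℚ) / 31⌋ - 1) ∧
    ((∃ t ∈ ({0, 6} : Finset ℕ), n ≡ t [MOD 31]) →
      (largestLCDMinWeight (ZMod 2) n 5 : ℤ) = ⌊(16 * n : ℚ) / 31⌋ - 2) := by
  have floor_eq : ⌊(16 * n : ℚ) / 31⌋ = (16 * n : ℤ) / 31 := by
    simpa using Rat.floor_intCast_div_natCast (16 * n) 31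
  rw [floor_eq]
  constructor <;> rintro ⟨t, ht, hmod⟩
  · rw [largestLCDMinWeight_five hn (Finset.mem_of_subset (by decide) ht) hmod]
    simp only [mem_insert, mem_singleton] at ht
    unfold Nat.ModEq at hmod
    omega
  · rw [largestLCDMinWeight_five hn (Finset.mem_of_subset (by decide) ht) hmod]
    simp only [mem_insert, mem_singleton] at ht
    unfold Nat.ModEq at hmod
    omega
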